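/- A loop is an algebra $(X,\cdot,\backslash,/,e)$ satisfying $x(x\backslash y)=y=x\backslash(xy)$, $(x/y)y=x=(xy)/y$ and $ex=x=xe$. Associativity *propagates* in a loop $X$ if, for all $x_1,x_2,x_3\in X$ with $x_1(x_2x_3)=(x_1x_2)x_3$, one has $y_1(y_2y_3)=(y_1y_2)y_3$ for all $y_1,y_2,y_3$ in the subloop $\langle x_1,x_2,x_3\rangle$ generated by $x_1,x_2,x_3$; it propagates in a class of loops if it propagates in every member of the class. A (finite) Steiner triple system consists of a finite set $V$ of points and a set of $3$-element subsets of $V$, called blocks, such that any two distinct points lie in exactly one block. It is *anti-Pasch* if it contains no four blocks of the form $\{a,b,c\},\{a,d,e\},\{f,b,d\},\{f,c,e\}$ with $a,b,c,d,e,f$ distinct, and *minimal* if each of its proper subsystems has at most one block. The associated Steiner loop is $V\cup\{e\}$ with identity element $e$, $xx=e$ for all $x$, and $xy=z$ whenever $\{x,y,z\}$ is a block (with $x,y,z$ distinct). **Corollary.** Let $X_1,\dots,X_n$ be the Steiner loops associated with minimal anti-Pasch Steiner triple systems. Then associativity propagates in the variety $\mathbf{HSP}(X_1,\dots,X_n)\lor\mathcal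 A$. Here $\mathbf{HSP}(X_1,\dots,X_n)$ is the class of all homomorphic images of subloops of direct products of copies of $X_1,\dots,X_n$, $\mathcal A$ is the variety of abelian groups, regarded as loops, and $\mathcal V\lor\mathcal W$ denotes the smallest variety (equationally defined class) of loops containing $\mathcal V$ and $\mathcal W$. -/

import Mathlib

universe u

namespace LoopTheory

/-- A loop in the universal-algebraic signature `(·, \, /, 1)`. -/
class Loop (X : Type*) extends Mul X, One X where
  ldiv : X → X → X
  rdiv : X → X → X
  mul_ldiv : ∀ x y : X, x * ldiv x y = y
  ldiv_mul : ∀ x y : X, ldiv x (x * y) = y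
  rdiv_mul : ∀ x y : X, rdiv x y * y = x
  mul_rdiv : ∀ x y : X, rdiv (x * y) y = x
  one_mul : ∀ x : X, 1 * x = x
  mul_one : ∀ x : X, x * 1 = x

/-- The direct product of a family of loops. -/
instance Loop.pi {ι : Type*} {X : ι → Type*} [∀ i, Loop (X i)] : Loop (∀ i, X i) where
  ldiv f g := fun i => Loop.ldiv (f i) (g i)
  rdiv f g := fun i => Loop.rdiv (f i) (g i)
  mul_ldiv f g := funext fun i => Loop.mul_ldiv (f i) (g i)
  ldiv_mul f g := funext fun i => Loop.ldiv_mul (f i) (g i)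
  rdiv_mul f g := funext fun i => Loop.rdiv_mul (f i) (g i)
  mul_rdiv f g := funext fun i => Loop.mul_rdiv (f i) (g i)
  one_mul f := funext fun i => Loop.one_mul (f i)
  mul_one f := funext fun i => Loop.mul_one (f i)

/-- Subloops: subsets closed under all operations of the signature. -/
structure Subloop (X : Type*) [Loop X] where
  carrier : Set X
  one_mem : (1 : X) ∈ carrier
  mul_mem : ∀ {x y : X}, x ∈ carrier → y ∈ carrier → x * y ∈ carrier
  ldiv_mem : ∀ {x y : X}, x ∈ carrier → y ∈ carrier → Loop.ldiv x y ∈ carrier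
  rdiv_mem : ∀ {x y : X}, x ∈ carrier → y ∈ carrier → Loop.rdiv x y ∈ carrier

/-- A subloop is itself a loop. -/
instance Subloop.instLoop {X : Type*} [Loop X] (A : Subloop X) : Loop A.carrier where
  mul a b := ⟨a.1 * b.1, A.mul_mem a.2 b.2⟩
  one := ⟨1, A.one_mem⟩
  ldiv a b := ⟨Loop.ldiv a.1 b.1, A.ldiv_mem a.2 b.2⟩
  rdiv a b := ⟨Loop.rdiv a.1 b.1, A.rdiv_mem a.2 b.2⟩
  mul_ldiv a b := Subtype.ext (Loop.mul_ldiv a.1 b.1)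
  ldiv_mul a b := Subtype.ext (Loop.ldiv_mul a.1 b.1)
  rdiv_mul a b := Subtype.ext (Loop.rdiv_mul a.1 b.1)
  mul_rdiv a b := Subtype.ext (Loop.mul_rdiv a.1 b.1)
  one_mul a := Subtype.ext (Loop.one_mul a.1)
  mul_one a := Subtype.ext (Loop.mul_one a.1)

/-- The subloop generated by a set: the intersection of all subloops containing it. -/
def Subloop.closure {X : Type*} [Loop X] (s : Set X) : Subloop X where
  carrier := {x | ∀ A : Subloop X, s ⊆ A.carrier → x ∈ A.carrier}
  one_mem := fun A _ => A.one_mem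
  mul_mem := fun hx hy A hA => A.mul_mem (hx A hA) (hy A hA)
  ldiv_mem := fun hx hy A hA => A.ldiv_mem (hx A hA) (hy A hA)
  rdiv_mem := fun hx hy A hA => A.rdiv_mem (hx A hA) (hy A hA)

/-- Loop terms in variables indexed by `α`. -/
inductive Term (α : Type) : Type
  | var : α → Term α
  | one : Term α
  | mul : Term α → Term α → Term α
  | ldiv : Term α → Term α → Term α
  | rdiv : Term α → Term α → Term α

/-- Evaluation of a term at an assignment of the variables. -/
def Term.eval {α : Type} {X : Type*} [Loop X] (v : α → X) : Term α → X
  | .var a => v a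
  | .one => 1
  | .mul s t => s.eval v * t.eval v
  | .ldiv s t => Loop.ldiv (s.eval v) (t.eval v)
  | .rdiv s t => Loop.rdiv (s.eval v) (t.eval v)

/-- Equations in the signature of loops, with variables indexed by `α`. -/
structure Equation (α : Type) where
  lhs : Term α
  rhs : Term α

/-- The equation holds at the tuple `v`. -/
def Equation.HoldsAt {α : Type} (ε : Equation α) {X : Type*} [Loop X] (v : α → X) : Prop :=
  ε.lhs.eval v = ε.rhs.eval v

/-- The equation `ε` in `n` variables propagates in the loop `X`. -/
def Propagates {n : ℕ} (ε : Equation (Fin n)) (X : Type*) [Loop X] : Prop :=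
  ∀ x : Fin n → X, ε.HoldsAt x →
    ∀ y : Fin n → X, (∀ i, y i ∈ (Subloop.closure (Set.range x)).carrier) → ε.HoldsAt y

/-- Associativity `x(yz) = (xy)z` as an equation in three variables. -/
def associativity : Equation (Fin 3) where
  lhs := .mul (.var 0) (.mul (.var 1) (.var 2))
  rhs := .mul (.mul (.var 0) (.var 1)) (.var 2)

/-- Bundled loops; classes of loops are elements of `Set LoopAlg`. -/
structure LoopAlg : Type (u + 1) where
  carrier : Type u
  [inst : Loop carrier]

attribute [instance] LoopAlg.inst

/-- The equation `ε` propagates in every member of the class `K`. -/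
def PropagatesIn {n : ℕ} (ε : Equation (Fin n)) (K : Set LoopAlg.{u}) : Prop :=
  ∀ X ∈ K, Propagates ε X.carrier

/-- All homomorphic images of members of `K` (loop homomorphisms are the multiplicative maps). -/
def classH (K : Set LoopAlg.{u}) : Set LoopAlg.{u} :=
  {Y | ∃ X ∈ K, ∃ f : X.carrier →ₙ* Y.carrier, Function.Surjective f}

/-- All subloops of members of `K`, up to isomorphism. -/
def classS (K : Set LoopAlg.{u}) : Set LoopAlg.{u} :=
  {Y | ∃ X ∈ K, ∃ A : Subloop X.carrier, Nonempty (Y.carrier ≃* A.carrier)}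

/-- All direct products of members of `K`, up to isomorphism. -/
def classP (K : Set LoopAlg.{u}) : Set LoopAlg.{u} :=
  {Y | ∃ (ι : Type u) (X : ι → LoopAlg.{u}), (∀ i, X i ∈ K) ∧
    Nonempty (Y.carrier ≃* ∀ i, (X i).carrier)}

/-- The class `HSP(K)`. -/
def HSP (K : Set LoopAlg.{u}) : Set LoopAlg.{u} :=
  classH (classS (classP K))

/-- A variety of loops is an equationally defined class of loops. -/
def IsVariety (K : Set LoopAlg.{u}) : Prop :=
  ∃ E : Set (Equation ℕ), K = {X | ∀ ε ∈ E, ∀ v : ℕ → X.carrier, ε.HoldsAt v}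

/-- The join of two varieties: the smallest variety containing both. -/
def varietyJoin (K L : Set LoopAlg.{u}) : Set LoopAlg.{u} :=
  {X | ∀ W : Set LoopAlg.{u}, IsVariety W → K ⊆ W → L ⊆ W → X ∈ W}

/-- The variety of abelian groups, as a class of loops. -/
def abelianGroups : Set LoopAlg.{u} :=
  {X | (∀ x y z : X.carrier, x * (y * z) = (x * y) * z) ∧ ∀ x y : X.carrier, x * y = y * x}

/-- A Steiner triple system with point set `V`: a set of three-element blocks such that any two
distinct points lie in exactly one block. -/
structure SteinerTripleSystem (V : Type*) where
  blocks : Set (Set V)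
  ncard_block : ∀ b ∈ blocks, b.ncard = 3
  existsUnique_block : ∀ x y : V, x ≠ y → ∃! b, b ∈ blocks ∧ x ∈ b ∧ y ∈ b

namespace SteinerTripleSystem

variable {V : Type u} (S : SteinerTripleSystem V)

/-- `T` is the point set of a subsystem: it contains the block through any two of its points. -/
def IsSubsystem (T : Set V) : Prop :=
  ∀ b ∈ S.blocks, ∀ x ∈ T, ∀ y ∈ T, x ≠ y → x ∈ b → y ∈ b → b ⊆ T

/-- Every proper subsystem has at most one block. -/
def IsMinimal : Prop :=
  ∀ T : Set V, S.IsSubsystem T → T ≠ Set.univ → {b ∈ S.blocks | b ⊆ T}.Subsingleton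

/-- There is no Pasch configuration, that is, no four blocks
`{a,b,c}, {a,d,e}, {f,b,d}, {f,c,e}` on six distinct points. -/
def IsAntiPasch : Prop :=
  ¬ ∃ a b c d e f : V, [a, b, c, d, e, f].Nodup ∧
    {a, b, c} ∈ S.blocks ∧ {a, d, e} ∈ S.blocks ∧ {f, b, d} ∈ S.blocks ∧ {f, c, e} ∈ S.blocks

theorem exists_third {x y : V} (h : x ≠ y) :
    ∃ z, z ≠ x ∧ z ≠ y ∧ ({x, y, z} : Set V) ∈ S.blocks := by
  obtain ⟨b, ⟨hb, hx, hy⟩, -⟩ := S.existsUnique_block x y h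
  have h3 := S.ncard_block b hb
  have hp : ({x, y} : Set V).ncard = 2 := Set.ncard_pair h
  have hsub : ({x, y} : Set V) ⊆ b := by
    rintro t (rfl | rfl) <;> assumption
  have hfin : b.Finite := Set.finite_of_ncard_ne_zero (by omega)
  obtain ⟨z, hz, hz'⟩ := Set.exists_mem_notMem_of_ncard_lt_ncard (s := {x, y}) (t := b)
    (by omega) (Set.toFinite _)
  simp only [Set.mem_insert_iff, Set.mem_singleton_iff, not_or] at hz'
  refine ⟨z, hz'.1, hz'.2, ?_⟩
  have h3' : ({x, y, z} : Set V).ncard = 3 :=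
    Set.ncard_eq_three.2 ⟨x, y, z, h, Ne.symm hz'.1, Ne.symm hz'.2, rfl⟩
  have hsub' : ({x, y, z} : Set V) ⊆ b := by
    rintro t (rfl | rfl | rfl) <;> assumption
  rw [Set.eq_of_subset_of_ncard_le hsub' (by omega) hfin]
  exact hb

theorem third_unique {x y z w : V} (h : x ≠ y)
    (hz : ({x, y, z} : Set V) ∈ S.blocks) (hw : ({x, y, w} : Set V) ∈ S.blocks) : z = w := by
  have he : ({x, y, z} : Set V) = {x, y, w} :=
    (S.existsUnique_block x y h).unique ⟨hz, by simp, by simp⟩ ⟨hw, by simp, by simp⟩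
  have h3 := S.ncard_block _ hz
  have hp : ({x, y} : Set V).ncard = 2 := Set.ncard_pair h
  have hzx : z ≠ x := by
    rintro rfl
    rw [show ({z, y, z} : Set V) = {z, y} by ext; simp; tauto] at h3
    omega
  have hzy : z ≠ y := by
    rintro rfl
    rw [show ({x, z, z} : Set V) = {x, z} by ext; simp] at h3
    omega
  have hm : z ∈ ({x, y, w} : Set V) := he ▸ (by simp)
  simpa [hzx, hzy] using hm

open Classical in
/-- The Steiner quasigroup of `S`: `x * x = x`, and for `x ≠ y` the product is the point `z` such
that `{x, y, z}` is a block. -/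
noncomputable def qmul (x y : V) : V :=
  if h : x = y then x else (S.exists_third h).choose

open Classical in
/-- The multiplication of the Steiner loop on `V ∪ {e}`, with `e = none`. -/
noncomputable def loopMul : Option V → Option V → Option V
  | none, y => y
  | some x, none => some x
  | some x, some y => if x = y then none else some (S.qmul x y)

theorem qmul_spec {x y : V} (h : x ≠ y) :
    S.qmul x y ≠ x ∧ S.qmul x y ≠ y ∧ ({x, y, S.qmul x y} : Set V) ∈ S.blocks := by
  rw [qmul, dif_neg h]
  exact (S.exists_third h).choose_spec

theorem qmul_eq {x y z : V} (h : x ≠ y) (hz : ({x, y, z} : Set V) ∈ S.blocks) :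
    S.qmul x y = z :=
  S.third_unique h (S.qmul_spec h).2.2 hz

theorem loopMul_comm (x y : Option V) : S.loopMul x y = S.loopMul y x := by
  rcases x with _ | x <;> rcases y with _ | y <;> try rfl
  by_cases h : x = y
  · subst h; rfl
  · have hb := (S.qmul_spec h).2.2
    rw [Set.insert_comm] at hb
    simp only [loopMul, if_neg h, if_neg (Ne.symm h)]
    rw [S.qmul_eq (Ne.symm h) hb]

theorem loopMul_loopMul (x y : Option V) : S.loopMul x (S.loopMul x y) = y := by
  rcases x with _ | x
  · rfl
  rcases y with _ | y
  · simp [loopMul]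
  by_cases h : x = y
  · subst h; simp [loopMul]
  · obtain ⟨h1, -, hb⟩ := S.qmul_spec h
    rw [Set.pair_comm] at hb
    simp only [loopMul, if_neg h, if_neg (Ne.symm h1)]
    rw [S.qmul_eq (Ne.symm h1) hb]

theorem loopMul_none (x : Option V) : S.loopMul x none = x := by
  cases x <;> rfl

/-- The Steiner loop associated with `S`; as `x(xy) = y` and the multiplication is commutative,
both divisions agree with the multiplication. -/
noncomputable def steinerLoop : LoopAlg.{u} where
  carrier := Option V
  inst :=
    { mul := S.loopMul
      one := none
      ldiv := S.loopMul
      rdiv := S.loopMul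
      mul_ldiv := S.loopMul_loopMul
      ldiv_mul := S.loopMul_loopMul
      rdiv_mul := fun x y => (S.loopMul_comm _ _).trans
        ((congrArg _ (S.loopMul_comm x y)).trans (S.loopMul_loopMul y x))
      mul_rdiv := fun x y => (S.loopMul_comm _ _).trans
        ((congrArg _ (S.loopMul_comm x y)).trans (S.loopMul_loopMul y x))
      one_mul := fun _ => rfl
      mul_one := S.loopMul_none }

end SteinerTripleSystem

end LoopTheory

/-! Anti-Pasch means that associating triples in a Steiner loop lie in a Klein subloop, hence
generate an associative one. With minimality, a nonassociating triple generates the whole loop, and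
a nonassociative loop of this kind is simple (`eq_univ_of_normal`).

Let `x` be an associating triple in a member of the join, and let `y i` be the value of a term `t i`
at `x`. The associator `t` of the `t i` evaluates to 1 at all triples in abelian groups and at all
associating triples in the Steiner loops. Only finitely many triples remain, all nonassociating. By
`exists_termKer_union_of_finite`, `t` can be corrected at these one by one without changing its
value at `x`. The corrected term is identically 1 in the generating classes, so in the join, whence
`t` is 1 at `x`. -/

namespace LoopTheory

/-! ### Cancellation and division in loops -/

namespace Loop

variable {X : Type*} [Loop X]

theorem mul_left_cancel {x y z : X} (h : x * y = x * z) : y = z := by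
  rw [← Loop.ldiv_mul x y, h, Loop.ldiv_mul]

theorem ldiv_eq_one_iff {x y : X} : Loop.ldiv x y = 1 ↔ y = x := by
  constructor
  · intro h
    rw [← Loop.mul_ldiv x y, h, Loop.mul_one]
  · rintro rfl
    apply mul_left_cancel (x := y)
    rw [Loop.mul_ldiv, Loop.mul_one]

theorem rdiv_self (x : X) : Loop.rdiv x x = 1 := by
  simpa [Loop.one_mul] using Loop.mul_rdiv (1 : X) x

theorem rdiv_one (x : X) : Loop.rdiv x 1 = x := by
  simpa [Loop.mul_one] using Loop.mul_rdiv x (1 : X)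

end Loop

/-! ### Steiner loops and their Klein subloops -/

/-- The laws of Steiner loops: commutativity and `x(xy) = y`. -/
structure IsSteinerLoop (X : Type*) [Loop X] : Prop where
  comm : ∀ x y : X, x * y = y * x
  mul_mul_self : ∀ x y : X, x * (x * y) = y

namespace IsSteinerLoop

variable {X : Type*} [Loop X] (h : IsSteinerLoop X)
include h

theorem mul_self (x : X) : x * x = 1 := by
  simpa [Loop.mul_one] using h.mul_mul_self x 1

theorem mul_self_mul (x y : X) : x * (y * x) = y := by
  rw [h.comm y x, h.mul_mul_self]

theorem self_mul_mul (x y : X) : (x * y) * x = y := by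
  rw [h.comm, h.mul_mul_self]

theorem mul_mul_self' (x y : X) : (x * y) * y = x := by
  rw [h.comm, h.mul_self_mul]

theorem ldiv_eq (x y : X) : Loop.ldiv x y = x * y := by
  rw [← h.mul_mul_self x (Loop.ldiv x y), Loop.mul_ldiv]

theorem rdiv_eq (x y : X) : Loop.rdiv x y = x * y := by
  rw [← h.mul_mul_self' (Loop.rdiv x y) y, Loop.rdiv_mul]

/-- The subset `{1, a, b, ab}` is a subloop. -/
theorem klein_mul_mem (a b : X) {x y : X} (hx : x ∈ ({1, a, b, a * b} : Set X))
    (hy : y ∈ ({1, a, b, a * b} : Set X)) : x * y ∈ ({1, a, b, a * b} : Set X) := by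
  have hba := h.comm b a
  rcases hx with rfl | rfl | rfl | rfl <;> rcases hy with rfl | rfl | rfl | rfl <;>
    simp [Loop.one_mul, Loop.mul_one, h.mul_self, h.mul_mul_self, h.mul_self_mul,
      h.self_mul_mul, h.mul_mul_self', hba]

/-- The subloop `{1, a, b, ab}` is associative. -/
theorem klein_assoc (a b : X) {x y z : X} (hx : x ∈ ({1, a, b, a * b} : Set X))
    (hy : y ∈ ({1, a, b, a * b} : Set X)) (hz : z ∈ ({1, a, b, a * b} : Set X)) :
    x * (y * z) = (x * y) * z := by
  have hba := h.comm b a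
  rcases hx with rfl | rfl | rfl | rfl <;> rcases hy with rfl | rfl | rfl | rfl <;>
    rcases hz with rfl | rfl | rfl | rfl <;>
    simp [Loop.one_mul, Loop.mul_one, h.mul_self, h.mul_mul_self, h.mul_self_mul,
      h.self_mul_mul, h.mul_mul_self', hba]

/-- The Klein subloop `{1, a, b, ab}`. -/
def kleinSubloop (a b : X) : Subloop X where
  carrier := {1, a, b, a * b}
  one_mem := by simp
  mul_mem hx hy := h.klein_mul_mem a b hx hy
  ldiv_mem hx hy := by rw [h.ldiv_eq]; exact h.klein_mul_mem a b hx hy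
  rdiv_mem hx hy := by rw [h.rdiv_eq]; exact h.klein_mul_mem a b hx hy

end IsSteinerLoop

/-! ### Minimal and anti-Pasch systems in terms of their loops -/

/-- The properties of the Steiner loop of a minimal anti-Pasch Steiner triple system: three
associating elements lie in a common Klein subloop, and a proper subloop is associative. -/
structure IsMinimalAntiPaschLoop (X : Type*) [Loop X] : Prop extends IsSteinerLoop X where
  degenerate : ∀ x y z : X, x * (y * z) = (x * y) * z →
    y = 1 ∨ z = 1 ∨ y = z ∨ x ∈ ({1, y, z, y * z} : Set X)
  minimal : ∀ A : Subloop X, ∀ x ∈ A.carrier, ∀ y ∈ A.carrier, ∀ z ∈ A.carrier,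
    x * (y * z) ≠ (x * y) * z → A.carrier = Set.univ

namespace SteinerTripleSystem

variable {V : Type u} (S : SteinerTripleSystem V)

theorem isSteinerLoop : IsSteinerLoop S.steinerLoop.carrier where
  comm := S.loopMul_comm
  mul_mul_self := S.loopMul_loopMul

theorem exists_some_mul_some {p q : V} (h : p ≠ q) :
    ∃ t : V, HMul.hMul (α := S.steinerLoop.carrier) (β := S.steinerLoop.carrier)
      (γ := S.steinerLoop.carrier) (some p) (some q) = some t ∧ t ≠ p ∧ t ≠ q ∧
      ({p, q, t} : Set V) ∈ S.blocks := by
  obtain ⟨h1, h2, h3⟩ := S.qmul_spec h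
  exact ⟨S.qmul p q, if_neg h, h1, h2, h3⟩

variable {S}

/-- In a nondegenerate case, the products `xy`, `yz`, `x(yz)` and `(xy)z` give four blocks, and
associativity makes the last two share their third point: a Pasch configuration. -/
theorem IsAntiPasch.degenerate (hS : S.IsAntiPasch) (x y z : S.steinerLoop.carrier)
    (hxyz : x * (y * z) = (x * y) * z) :
    y = 1 ∨ z = 1 ∨ y = z ∨ x ∈ ({1, y, z, y * z} : Set S.steinerLoop.carrier) := by
  by_contra hcon
  simp only [Set.mem_insert_iff, Set.mem_singleton_iff, not_or] at hcon
  obtain ⟨hy, hz, hyz, hx, hxy, hxz, hxyz'⟩ := hcon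
  have hL := S.isSteinerLoop
  have e1 : x * y ≠ z := fun e => hxyz' (by rw [← e, hL.mul_self_mul])
  have e2 : x * y ≠ y * z := fun e => hxz (by
    rw [hL.comm x y] at e; exact Loop.mul_left_cancel e)
  have e3 : x * (y * z) ≠ y := fun e => e2 (by
    rw [← hL.mul_mul_self x (y * z), e])
  obtain _ | p := x
  · exact hx rfl
  obtain _ | q := y
  · exact hy rfl
  obtain _ | r := z
  · exact hz rfl
  have hpq : p ≠ q := fun e => hxy (congrArg some e)
  have hpr : p ≠ r := fun e => hxz (congrArg some e)
  have hqr : q ≠ r := fun e => hyz (congrArg some e)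
  obtain ⟨t, ht, htp, htq, hbt⟩ := S.exists_some_mul_some hpq
  obtain ⟨s, hs, hsq, hsr, hbs⟩ := S.exists_some_mul_some hqr
  rw [hs] at hxyz' e2 e3 hxyz
  rw [ht] at e1 e2 hxyz
  have hps : p ≠ s := fun e => hxyz' (congrArg some e)
  have htr : t ≠ r := fun e => e1 (congrArg some e)
  have hts : t ≠ s := fun e => e2 (congrArg some e)
  obtain ⟨w, hw, hwp, hws, hbw⟩ := S.exists_some_mul_some hps
  obtain ⟨w', hw', hwt, hwr, hbw'⟩ := S.exists_some_mul_some htr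
  rw [hw] at hxyz e3
  rw [hw'] at hxyz
  obtain rfl : w = w' := Option.some.inj hxyz
  have hwq : w ≠ q := fun e => e3 (congrArg some e)
  refine hS ⟨q, p, t, s, r, w, ?_, ?_, ?_, ?_, ?_⟩
  · simp only [List.nodup_cons, List.mem_cons, List.not_mem_nil, or_false, not_or,
      not_false_eq_true, List.nodup_nil, and_true]
    exact ⟨⟨hpq.symm, htq.symm, hsq.symm, hqr, hwq.symm⟩, ⟨htp.symm, hps, hpr, hwp.symm⟩,
      ⟨hts, htr, hwt.symm⟩, ⟨hsr, hws.symm⟩, hwr.symm⟩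
  · rwa [Set.insert_comm]
  · rwa [Set.pair_comm]
  · rwa [Set.insert_comm, Set.pair_comm]
  · rwa [Set.insert_comm, Set.pair_comm]

/-- The points in a subloop form a subsystem. If it is proper, the blocks through `x, y` and through
`y, z` coincide, so the three elements lie in a Klein subloop and associate. -/
theorem IsMinimal.eq_univ (hS : S.IsMinimal) (A : Subloop S.steinerLoop.carrier)
    (x : S.steinerLoop.carrier) (hxA : x ∈ A.carrier) (y : S.steinerLoop.carrier)
    (hyA : y ∈ A.carrier) (z : S.steinerLoop.carrier) (hzA : z ∈ A.carrier)
    (hxyz : x * (y * z) ≠ (x * y) * z) : A.carrier = Set.univ := by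
  have hL := S.isSteinerLoop
  have hx : x ≠ 1 := by rintro rfl; exact hxyz (hL.klein_assoc y z (by simp) (by simp) (by simp))
  have hy : y ≠ 1 := by rintro rfl; exact hxyz (hL.klein_assoc x z (by simp) (by simp) (by simp))
  have hz : z ≠ 1 := by rintro rfl; exact hxyz (hL.klein_assoc x y (by simp) (by simp) (by simp))
  have hxy : x ≠ y := by
    rintro rfl; exact hxyz (hL.klein_assoc x z (by simp) (by simp) (by simp))
  have hyz : y ≠ z := by
    rintro rfl; exact hxyz (hL.klein_assoc x y (by simp) (by simp) (by simp))
  have hxz : x ≠ z := by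
    rintro rfl; exact hxyz (hL.klein_assoc x y (by simp) (by simp) (by simp))
  have hx' : x ≠ y * z := by
    rintro rfl; exact hxyz (hL.klein_assoc y z (by simp) (by simp) (by simp))
  have hsub : S.IsSubsystem {p | (some p : S.steinerLoop.carrier) ∈ A.carrier} := by
    intro b hb p hp q hq hpq hpb hqb
    obtain ⟨t, ht, -, -, hbt⟩ := S.exists_some_mul_some hpq
    rw [(S.existsUnique_block p q hpq).unique ⟨hb, hpb, hqb⟩ ⟨hbt, by simp, by simp⟩]
    have htA : (some t : S.steinerLoop.carrier) ∈ A.carrier := ht ▸ A.mul_mem hp hq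
    rintro w (rfl | rfl | rfl)
    exacts [hp, hq, htA]
  by_cases hT : {p | (some p : S.steinerLoop.carrier) ∈ A.carrier} = Set.univ
  · refine Set.eq_univ_of_forall fun w => ?_
    obtain _ | w := w
    · exact A.one_mem
    · exact (Set.ext_iff.1 hT w).2 trivial
  · exfalso
    have hone := hS _ hsub hT
    obtain _ | p := x
    · exact hx rfl
    obtain _ | q := y
    · exact hy rfl
    obtain _ | r := z
    · exact hz rfl
    have hpq : p ≠ q := fun e => hxy (congrArg some e)
    have hqr : q ≠ r := fun e => hyz (congrArg some e)
    obtain ⟨t, ht, htp, htq, hbt⟩ := S.exists_some_mul_some hpq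
    obtain ⟨s, hs, hsq, hsr, hbs⟩ := S.exists_some_mul_some hqr
    have htA : (some t : S.steinerLoop.carrier) ∈ A.carrier := ht ▸ A.mul_mem hxA hyA
    have hsA : (some s : S.steinerLoop.carrier) ∈ A.carrier := hs ▸ A.mul_mem hyA hzA
    have heq : ({p, q, t} : Set V) = {q, r, s} := by
      refine hone ⟨hbt, ?_⟩ ⟨hbs, ?_⟩
      · rintro w (rfl | rfl | rfl)
        exacts [hxA, hyA, htA]
      · rintro w (rfl | rfl | rfl)
        exacts [hyA, hzA, hsA]
    have hp : p ∈ ({q, r, s} : Set V) := heq ▸ (by simp)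
    rcases hp with rfl | rfl | rfl
    · exact hpq rfl
    · exact hxz rfl
    · exact hx' hs.symm

theorem isMinimalAntiPaschLoop (hmin : S.IsMinimal) (hpasch : S.IsAntiPasch) :
    IsMinimalAntiPaschLoop S.steinerLoop.carrier where
  toIsSteinerLoop := S.isSteinerLoop
  degenerate := hpasch.degenerate
  minimal := hmin.eq_univ

end SteinerTripleSystem

/-! ### Simplicity -/

namespace IsMinimalAntiPaschLoop

variable {X : Type*} [Loop X] (h : IsMinimalAntiPaschLoop X)
include h

/-- Three associating elements lie in a Klein subloop. -/
theorem exists_kleinSubloop {x y z : X} (hxyz : x * (y * z) = (x * y) * z) :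
    ∃ a b : X, x ∈ ({1, a, b, a * b} : Set X) ∧ y ∈ ({1, a, b, a * b} : Set X) ∧
      z ∈ ({1, a, b, a * b} : Set X) := by
  rcases h.degenerate x y z hxyz with rfl | rfl | rfl | hx
  · exact ⟨x, z, by simp, by simp, by simp⟩
  · exact ⟨x, y, by simp, by simp, by simp⟩
  · exact ⟨x, y, by simp, by simp, by simp⟩
  · exact ⟨y, z, hx, by simp, by simp⟩

/-- Simplicity: a nontrivial normal subloop of a nonassociative minimal anti-Pasch loop is
everything. -/
theorem eq_univ_of_normal {u v w : X} (huvw : u * (v * w) ≠ (u * v) * w) (I : Subloop X)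
    (hmul : ∀ x y : X, ∀ a ∈ I.carrier, Loop.ldiv (x * y) (x * (y * a)) ∈ I.carrier)
    (hcoset : ∀ x : X, ∀ a ∈ I.carrier, ∀ b ∈ I.carrier,
      Loop.ldiv x ((x * a) * b) ∈ I.carrier)
    {s : X} (hs : s ∈ I.carrier) (hs1 : s ≠ 1) : I.carrier = Set.univ := by
  by_contra hI
  have hassoc : ∀ x ∈ I.carrier, ∀ y ∈ I.carrier, ∀ z ∈ I.carrier,
      x * (y * z) = (x * y) * z := fun x hx y hy z hz => by
    by_contra hne
    exact hI (h.minimal I x hx y hy z hz hne)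
  -- Being associative, `I` has at most four elements: it is `{1, s, b, sb}` or `{1, s}`.
  by_cases hb : ∃ b ∈ I.carrier, b ≠ 1 ∧ b ≠ s
  · obtain ⟨b, hb, hb1, hbs⟩ := hb
    obtain ⟨x, hx⟩ := (Set.ne_univ_iff_exists_notMem _).1 hI
    have hmem : ∀ c ∈ I.carrier, c ∈ ({1, s, b, s * b} : Set X) := fun c hc => by
      rcases h.degenerate c s b (hassoc c hc s hs b hb) with h1 | h1 | h1 | h1
      exacts [absurd h1 hs1, absurd h1 hb1, absurd h1.symm hbs, h1]
    -- For `x` outside `I`, normality gives `(xs)b = xc` with `c` in `I`. Cancellation excludes `c =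
    -- 1, s, b`, and `c = sb` makes `x, s, b` associate, which forces `x` into `I`.
    have key : ∀ c, Loop.ldiv x ((x * s) * b) = c → (x * s) * b = x * c := by
      rintro c rfl
      rw [Loop.mul_ldiv]
    rcases hmem _ (hcoset x s hs b hb) with h1 | h1 | h1 | h1
    · have := key _ h1
      rw [Loop.mul_one] at this
      have h2 : x * s = x * b := by
        rw [← h.mul_mul_self' (x * s) b, this]
      exact hbs (Loop.mul_left_cancel h2).symm
    · have := key _ h1
      exact hb1 (Loop.mul_left_cancel (this.trans (Loop.mul_one _).symm))
    · have := key _ h1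
      rw [h.comm, h.comm x b] at this
      exact hs1 (Loop.mul_left_cancel ((Loop.mul_left_cancel this).trans (Loop.mul_one _).symm))
    · rcases h.degenerate x s b (key _ h1).symm with h2 | h2 | h2 | h2
      · exact hs1 h2
      · exact hb1 h2
      · exact hbs h2.symm
      · apply hx
        rcases h2 with rfl | rfl | rfl | rfl
        exacts [I.one_mem, hs, hb, I.mul_mem hs hb]
  · push Not at hb
    -- Here `I = {1, s}`. By normality `x(ys)` is `xy` or `(xy)s`, and the former gives `s = 1`. So
    -- `s` associates with everything, and the whole loop is a Klein subloop, contrary to `huvw`.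
    have hass : ∀ x y : X, x * (y * s) = (x * y) * s := fun x y => by
      have hm := hmul x y s hs
      by_cases h1 : Loop.ldiv (x * y) (x * (y * s)) = 1
      · rw [Loop.ldiv_eq_one_iff] at h1
        exact absurd (Loop.mul_left_cancel ((Loop.mul_left_cancel h1).trans
          (Loop.mul_one _).symm)) hs1
      · rw [← hb _ hm h1, Loop.mul_ldiv, hb _ hm h1]
    have hklein : ∀ y : X, y ≠ 1 → y ≠ s → ∀ x : X, x ∈ ({1, y, s, y * s} : Set X) := by
      intro y hy1 hys x
      rcases h.degenerate x y s (hass x y) with h1 | h1 | h1 | h1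
      exacts [absurd h1 hy1, absurd h1 hs1, absurd h1 hys, h1]
    by_cases hy : ∃ y : X, y ≠ 1 ∧ y ≠ s
    · obtain ⟨y, hy1, hys⟩ := hy
      exact huvw (h.klein_assoc y s (hklein y hy1 hys u) (hklein y hy1 hys v) (hklein y hy1 hys w))
    · push Not at hy
      have hy' : ∀ x : X, x ∈ ({1, s, s, s * s} : Set X) := fun x => by
        by_cases hx : x = 1
        · simp [hx]
        · simp [hy x hx]
      exact huvw (h.klein_assoc s s (hy' u) (hy' v) (hy' w))

end IsMinimalAntiPaschLoop

/-! ### Terms, and equations preserved by `HSP` and joins -/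

namespace Term

/-- Renaming of variables. -/
def rename {α β : Type} (f : α → β) : Term α → Term β
  | .var a => .var (f a)
  | .one => .one
  | .mul s t => .mul (s.rename f) (t.rename f)
  | .ldiv s t => .ldiv (s.rename f) (t.rename f)
  | .rdiv s t => .rdiv (s.rename f) (t.rename f)

theorem eval_rename {α β : Type} (f : α → β) {X : Type*} [Loop X] (v : β → X) (t : Term α) :
    (t.rename f).eval v = t.eval (v ∘ f) := by
  induction t <;> simp_all [rename, eval]

/-- The elements expressible by terms in `v` form a subloop. -/
def evalRange {α : Type} {X : Type*} [Loop X] (v : α → X) : Subloop X where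
  carrier := Set.range fun t : Term α => t.eval v
  one_mem := ⟨.one, rfl⟩
  mul_mem := by rintro _ _ ⟨s, rfl⟩ ⟨t, rfl⟩; exact ⟨.mul s t, rfl⟩
  ldiv_mem := by rintro _ _ ⟨s, rfl⟩ ⟨t, rfl⟩; exact ⟨.ldiv s t, rfl⟩
  rdiv_mem := by rintro _ _ ⟨s, rfl⟩ ⟨t, rfl⟩; exact ⟨.rdiv s t, rfl⟩

theorem exists_eval_of_mem_closure {α : Type} {X : Type*} [Loop X] {v : α → X} {x : X}
    (hx : x ∈ (Subloop.closure (Set.range v)).carrier) : ∃ t : Term α, t.eval v = x := by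
  refine hx (evalRange v) ?_
  rintro _ ⟨a, rfl⟩
  exact ⟨.var a, rfl⟩

theorem eval_mem {α : Type} {X : Type*} [Loop X] {v : α → X} (A : Subloop X)
    (hv : ∀ a, v a ∈ A.carrier) (t : Term α) : t.eval v ∈ A.carrier := by
  induction t with
  | var a => exact hv a
  | one => exact A.one_mem
  | mul s t hs ht => exact A.mul_mem hs ht
  | ldiv s t hs ht => exact A.ldiv_mem hs ht
  | rdiv s t hs ht => exact A.rdiv_mem hs ht

/-- A map compatible with multiplication is compatible with the evaluation of terms. -/
theorem map_eval {α : Type} {X Y : Type*} [Loop X] [Loop Y] (f : X → Y)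
    (hf : ∀ x y, f (x * y) = f x * f y) (v : α → X) (t : Term α) :
    f (t.eval v) = t.eval (f ∘ v) := by
  induction t with
  | var a => rfl
  | one =>
    apply Loop.mul_left_cancel (x := f 1)
    simp only [eval]
    rw [← hf, Loop.mul_one, Loop.mul_one]
  | mul s t hs ht => simp only [eval, hf, hs, ht]
  | ldiv s t hs ht =>
    apply Loop.mul_left_cancel (x := f (s.eval v))
    simp only [eval]
    rw [← hf, Loop.mul_ldiv, hs, Loop.mul_ldiv, ht]
  | rdiv s t hs ht =>
    simp only [eval]
    rw [← Loop.mul_rdiv (f _) (f (t.eval v)), ← hf, Loop.rdiv_mul, hs, ht]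

theorem eval_pi {α : Type} {ι : Type*} {X : ι → Type*} [∀ i, Loop (X i)] (v : α → ∀ i, X i)
    (t : Term α) (i : ι) : t.eval v i = t.eval fun a => v a i := by
  induction t with
  | var a => rfl
  | one => rfl
  | mul s t hs ht => exact congrArg₂ (· * ·) hs ht
  | ldiv s t hs ht => exact congrArg₂ Loop.ldiv hs ht
  | rdiv s t hs ht => exact congrArg₂ Loop.rdiv hs ht

/-- The term measuring the failure of associativity of three terms. -/
def associator {α : Type} (r s t : Term α) : Term α :=
  .ldiv (.mul r (.mul s t)) (.mul (.mul r s) t)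

theorem eval_associator_eq_one {α : Type} {X : Type*} [Loop X] {v : α → X} {r s t : Term α} :
    (associator r s t).eval v = 1 ↔
      r.eval v * (s.eval v * t.eval v) = (r.eval v * s.eval v) * t.eval v :=
  Loop.ldiv_eq_one_iff.trans eq_comm

end Term

/-- The class `HSP(K)` satisfies the equations of `K`. -/
theorem holdsAt_of_mem_HSP {α : Type} {K : Set LoopAlg.{u}} {ε : Equation α}
    (hK : ∀ X ∈ K, ∀ v : α → X.carrier, ε.HoldsAt v) {Y : LoopAlg.{u}} (hY : Y ∈ HSP K)
    (v : α → Y.carrier) : ε.HoldsAt v := by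
  obtain ⟨Z, ⟨P, ⟨ι, X, hX, ⟨g⟩⟩, A, ⟨k⟩⟩, f, hf⟩ := hY
  choose w hw using fun a => hf (v a)
  let m : Z.carrier → ∀ i, (X i).carrier := fun z => g (k z : P.carrier)
  have hm : ∀ x y, m (x * y) = m x * m y := fun x y => by
    change g (k (x * y) : P.carrier) = _
    rw [map_mul]
    exact map_mul g _ _
  have hinj : Function.Injective m :=
    g.injective.comp (Subtype.val_injective.comp k.injective)
  have hv : v = f ∘ w := funext fun a => (hw a).symm
  unfold Equation.HoldsAt
  rw [hv, ← Term.map_eval f (map_mul f), ← Term.map_eval f (map_mul f)]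
  congr 1
  apply hinj
  rw [Term.map_eval m hm, Term.map_eval m hm]
  funext i
  rw [Term.eval_pi, Term.eval_pi]
  exact hK _ (hX i) _

/-- Equations valid in `K` and in `L` are valid in the join. -/
theorem eval_eq_one_of_mem_varietyJoin {K L : Set LoopAlg.{u}} {t : Term (Fin 3)}
    (hK : ∀ X ∈ K, ∀ v : Fin 3 → X.carrier, t.eval v = 1)
    (hL : ∀ X ∈ L, ∀ v : Fin 3 → X.carrier, t.eval v = 1)
    {Y : LoopAlg.{u}} (hY : Y ∈ varietyJoin (HSP K) L) (v : Fin 3 → Y.carrier) :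
    t.eval v = 1 := by
  let ε : Equation ℕ := ⟨t.rename Fin.val, .one⟩
  have hε : ∀ X : LoopAlg.{u}, (∀ v : Fin 3 → X.carrier, t.eval v = 1) →
      ∀ v : ℕ → X.carrier, ε.HoldsAt v := fun X hX w => by
    change (t.rename Fin.val).eval w = 1
    rw [Term.eval_rename, hX]
  have hmem := hY {X | ∀ δ ∈ ({ε} : Set (Equation ℕ)), ∀ v : ℕ → X.carrier, δ.HoldsAt v}
    ⟨{ε}, rfl⟩
    (by
      rintro X hX _ rfl w
      exact holdsAt_of_mem_HSP (fun X hX => hε X (hK X hX)) hX w)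
    (by
      rintro X hX _ rfl w
      exact hε X (hL X hX) w)
  -- The value 1 beyond the first three variables is immaterial: they do not occur in the renamed
  -- term.
  have h := hmem ε rfl fun k => if hk : k < 3 then v ⟨k, hk⟩ else 1
  change (t.rename Fin.val).eval _ = 1 at h
  rw [Term.eval_rename] at h
  convert h using 2
  funext i
  simp

/-! ### Kernels of evaluation -/

/-- A loop together with a triple of elements. -/
abbrev TripleLoop : Type (u + 1) := Σ X : LoopAlg.{u}, Fin 3 → X.carrier

/-- The terms in three variables that evaluate to `1` at every triple in `C`. -/
def termKer (C : Set TripleLoop.{u}) : Set (Term (Fin 3)) :=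
  {t | ∀ p ∈ C, t.eval p.2 = 1}

theorem termKer_union (C D : Set TripleLoop.{u}) :
    termKer (C ∪ D) = termKer C ∩ termKer D := by
  ext t
  simp only [termKer, Set.mem_union, or_imp, forall_and, Set.mem_inter_iff, Set.mem_ofPred_eq]

/-- The values at `v` of the terms in `termKer C`. -/
def termKerImage (C : Set TripleLoop.{u}) {X : Type*} [Loop X] (v : Fin 3 → X) : Subloop X where
  carrier := Set.image (fun t : Term (Fin 3) => t.eval v) (termKer C)
  one_mem := ⟨.one, fun _ _ => rfl, rfl⟩
  mul_mem := by
    rintro _ _ ⟨s, hs, rfl⟩ ⟨t, ht, rfl⟩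
    exact ⟨.mul s t, fun p hp => by simp [Term.eval, hs p hp, ht p hp, Loop.one_mul], rfl⟩
  ldiv_mem := by
    rintro _ _ ⟨s, hs, rfl⟩ ⟨t, ht, rfl⟩
    exact ⟨.ldiv s t, fun p hp => by
      simp [Term.eval, hs p hp, ht p hp, Loop.ldiv_eq_one_iff], rfl⟩
  rdiv_mem := by
    rintro _ _ ⟨s, hs, rfl⟩ ⟨t, ht, rfl⟩
    exact ⟨.rdiv s t, fun p hp => by
      simp [Term.eval, hs p hp, ht p hp, Loop.rdiv_self], rfl⟩

namespace IsMinimalAntiPaschLoop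

variable {X : Type*} [Loop X] (h : IsMinimalAntiPaschLoop X) {v : Fin 3 → X}
  (hv : ¬ associativity.HoldsAt v)
include h hv

/-- The values of terms form a subloop containing the nonassociating triple `v`, so minimality
applies. -/
theorem eval_surjective (x : X) : ∃ t : Term (Fin 3), t.eval v = x := by
  have hu := h.minimal (Term.evalRange v) (v 0) ⟨.var 0, rfl⟩ (v 1) ⟨.var 1, rfl⟩
    (v 2) ⟨.var 2, rfl⟩ hv
  exact (Set.ext_iff.1 hu x).2 trivial

/-- Simplicity applies: every element of `X` lifts to a term, and the normality conditions hold on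
terms because kernel terms act as 1 on `C`. -/
theorem termKerImage_eq_univ {C : Set TripleLoop.{u}} {t : Term (Fin 3)} (ht : t ∈ termKer C)
    (htv : t.eval v ≠ 1) : (termKerImage C v).carrier = Set.univ := by
  refine h.eq_univ_of_normal hv _ ?_ ?_ ⟨t, ht, rfl⟩ htv
  · rintro x y _ ⟨a, ha, rfl⟩
    obtain ⟨x, rfl⟩ := h.eval_surjective hv x
    obtain ⟨y, rfl⟩ := h.eval_surjective hv y
    exact ⟨.ldiv (.mul x y) (.mul x (.mul y a)), fun p hp => by
      simp [Term.eval, ha p hp, Loop.mul_one, Loop.ldiv_eq_one_iff], rfl⟩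
  · rintro x _ ⟨a, ha, rfl⟩ _ ⟨b, hb, rfl⟩
    obtain ⟨x, rfl⟩ := h.eval_surjective hv x
    exact ⟨.ldiv x (.mul (.mul x a) b), fun p hp => by
      simp [Term.eval, ha p hp, hb p hp, Loop.mul_one, Loop.ldiv_eq_one_iff], rfl⟩

/-- If two kernels have nontrivial image in a nonassociative minimal anti-Pasch loop, then their
intersection maps onto it. -/
theorem exists_mem_termKer_union {C D : Set TripleLoop.{u}} {s t : Term (Fin 3)}
    (hs : s ∈ termKer C) (hsv : s.eval v ≠ 1) (ht : t ∈ termKer D) (htv : t.eval v ≠ 1) (x : X) :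
    ∃ r ∈ termKer (C ∪ D), r.eval v = x := by
  have hC := h.termKerImage_eq_univ hv hs hsv
  have hD := h.termKerImage_eq_univ hv ht htv
  obtain ⟨a, ha, hav⟩ := (Set.ext_iff.1 hC (v 0)).2 trivial
  obtain ⟨b, hb, hbv⟩ := (Set.ext_iff.1 hD (v 1)).2 trivial
  -- An associator vanishes once one entry does: `a` takes care of `C` and `b` of `D`. At `v` its
  -- entries are those of `v` itself, so it is nontrivial there.
  have hm : Term.associator a b (.var 2) ∈ termKer (C ∪ D) := by
    rw [termKer_union]
    refine ⟨fun p hp => ?_, fun p hp => ?_⟩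
    · rw [Term.eval_associator_eq_one, ha p hp, Loop.one_mul, Loop.one_mul]
    · rw [Term.eval_associator_eq_one, hb p hp, Loop.one_mul, Loop.mul_one]
  have hne : (Term.associator a b (.var 2)).eval v ≠ 1 := fun he => by
    rw [Term.eval_associator_eq_one] at he
    simp only at hav hbv
    rw [hav, hbv] at he
    exact hv he
  exact (Set.ext_iff.1 (h.termKerImage_eq_univ hv hm hne) x).2 trivial

end IsMinimalAntiPaschLoop

/-- Let `q` be an associating triple. Modulo `q`, a term in the kernel of `B` may be replaced by
one that moreover vanishes at finitely many given nonassociating triples in minimal anti-Pasch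
loops. -/
theorem exists_termKer_union_of_finite (B : Set TripleLoop.{u}) (q : TripleLoop.{u})
    (hq : associativity.HoldsAt q.2) {J : Set TripleLoop.{u}} (hJ : J.Finite)
    (hmin : ∀ p ∈ J, IsMinimalAntiPaschLoop p.1.carrier)
    (hne : ∀ p ∈ J, ¬ associativity.HoldsAt p.2) {t : Term (Fin 3)} (ht : t ∈ termKer B) :
    ∃ s ∈ termKer (B ∪ J), s.eval q.2 = t.eval q.2 := by
  induction J, hJ using Set.Finite.induction_on with
  | empty => exact ⟨t, by simpa using ht, rfl⟩
  | @insert p J _ _ ih =>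
    obtain ⟨s, hs, hst⟩ := ih (fun p hp => hmin p (Or.inr hp)) (fun p hp => hne p (Or.inr hp))
    have hunion : termKer (B ∪ insert p J) = termKer (B ∪ J) ∩ termKer {p} := by
      rw [← termKer_union, Set.union_assoc, Set.union_singleton]
    by_cases hsp : s.eval p.2 = 1
    · exact ⟨s, hunion ▸ ⟨hs, by rintro _ rfl; exact hsp⟩, hst⟩
    · have hp := hmin p (Or.inl rfl)
      have hnp := hne p (Or.inl rfl)
      -- The associator of the variables vanishes at `q` but not at `p`, while `s` vanishes on `B ∪
      -- J` but not at `p`. Hence some `r` vanishes at `q` and on `B ∪ J` and agrees with `s` at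
      -- `p`; the quotient `s / r` is the correction.
      obtain ⟨r, hr, hrp⟩ := hp.exists_mem_termKer_union hnp (C := {q}) (D := B ∪ J)
        (s := Term.associator (.var 0) (.var 1) (.var 2))
        (by rintro _ rfl; exact Term.eval_associator_eq_one.2 hq)
        (fun he => hnp (Term.eval_associator_eq_one.1 he)) hs hsp (s.eval p.2)
      rw [termKer_union] at hr
      refine ⟨.rdiv s r, hunion ▸ ⟨fun c hc => ?_, ?_⟩, ?_⟩
      · simp [Term.eval, hs c hc, hr.2 c hc, Loop.rdiv_self]
      · rintro _ rfl
        simp [Term.eval, hrp, Loop.rdiv_self]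
      · simp [Term.eval, hr.1 q rfl, Loop.rdiv_one, hst]

end LoopTheory

/-! ### Propagation in the join -/

theorem mainTheorem10 (n : ℕ) (V : Fin n → Type u) [∀ i, Finite (V i)]
    (S : ∀ i, LoopTheory.SteinerTripleSystem (V i))
    (hmin : ∀ i, (S i).IsMinimal) (hpasch : ∀ i, (S i).IsAntiPasch) :
    LoopTheory.PropagatesIn LoopTheory.associativity
      (LoopTheory.varietyJoin
        (LoopTheory.HSP (Set.range fun i => (S i).steinerLoop))
        LoopTheory.abelianGroups) := by
  intro Y hY x hx y hy
  have hS : ∀ i, LoopTheory.IsMinimalAntiPaschLoop (S i).steinerLoop.carrier := fun i =>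
    LoopTheory.SteinerTripleSystem.isMinimalAntiPaschLoop (hmin i) (hpasch i)
  let F : (Σ i, Fin 3 → (S i).steinerLoop.carrier) → LoopTheory.TripleLoop :=
    fun p => ⟨(S p.1).steinerLoop, p.2⟩
  -- `B` may be infinite, since the associator already vanishes on it; only `J`, where corrections
  -- are made, must be finite.
  let B : Set LoopTheory.TripleLoop :=
    {p | p.1 ∈ LoopTheory.abelianGroups} ∪ Set.image F {p | LoopTheory.associativity.HoldsAt p.2}
  let J : Set LoopTheory.TripleLoop := Set.image F {p | ¬ LoopTheory.associativity.HoldsAt p.2}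
  have hfin : J.Finite := by
    have : ∀ i, Finite (S i).steinerLoop.carrier := fun i => inferInstanceAs (Finite (Option (V i)))
    exact Set.toFinite _
  choose t ht using fun i => LoopTheory.Term.exists_eval_of_mem_closure (hy i)
  have hB : LoopTheory.Term.associator (t 0) (t 1) (t 2) ∈ LoopTheory.termKer B := by
    rintro _ (hp | ⟨⟨i, v⟩, hv, rfl⟩)
    · exact LoopTheory.Term.eval_associator_eq_one.2 (hp.1 _ _ _)
    · obtain ⟨a, b, h0, h1, h2⟩ := (hS i).exists_kleinSubloop hv
      have hK := LoopTheory.Term.eval_mem ((hS i).kleinSubloop a b) (v := v)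
        (by intro k; fin_cases k <;> assumption)
      exact LoopTheory.Term.eval_associator_eq_one.2
        ((hS i).klein_assoc a b (hK (t 0)) (hK (t 1)) (hK (t 2)))
  obtain ⟨s, hs, hst⟩ := LoopTheory.exists_termKer_union_of_finite B ⟨Y, x⟩ hx hfin
    (by rintro _ ⟨⟨i, v⟩, -, rfl⟩; exact hS i) (by rintro _ ⟨p, hp, rfl⟩; exact hp) hB
  -- `B` and `J` together exhaust all triples in the generating loops, so `s = 1` is an identity
  -- there.
  have hs1 : s.eval x = 1 := by
    refine LoopTheory.eval_eq_one_of_mem_varietyJoin ?_ ?_ hY x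
    · rintro _ ⟨i, rfl⟩ v
      by_cases hv : LoopTheory.associativity.HoldsAt v
      · exact hs _ (Or.inl (Or.inr ⟨⟨i, v⟩, hv, rfl⟩))
      · exact hs _ (Or.inr ⟨⟨i, v⟩, hv, rfl⟩)
    · exact fun X hX v => hs ⟨X, v⟩ (Or.inl (Or.inl hX))
  have h1 := LoopTheory.Term.eval_associator_eq_one.1 (hst.symm.trans hs1)
  simp only [ht] at h1
  exact h1
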